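/- Let $N$ (agents) and $M$ (items) be finite sets with $|N|=|M|$, and let $R=(\succ_j)_{j\in N}$ be a profile of strict linear orders on $M$. For $S\subseteq M$ nonempty, $\mathrm{top}_j(S)$ is the $\succ_j$-best item of $S$, and $U_j(o)=\{o'\in M: o'\succ_j o\}\cup\{o\}$. A random assignment is a doubly stochastic matrix $P=(p_{j,o})_{j\in N,o\in M}$. Ex-ante FERI. Given $P$, define recursively for $r=1,2,\dots$ the sets $M_{P,r}=\{o\in M:\sum_{k\in\bigcup_{1\le r'<r}E_{P,r'}(o)}p_{k,o}<1\}$ and, for $o \in M$, $E_{P,r}(o)=\{j\in N: o\in M_{P,r},\ o=\mathrm{top}_j(M_{P,r})\}$. The random assignment $P$ satisfies ex-ante favoring-eagerness-for-remaining-items (ex-ante FERI) if for every $r\ge 1$, every $o\in M_{P,r}$ and every agent $j$ with $j\in E_{P,r'}(o)$ for some $1\le r'<r$, we have $\sum_{o'\in U_j(o)}p_{j,o'}=1$. The algorithm $\mathrm{PRE}_\omega$. A collection of eating speed functions is a family $\omega=(\omega_j)_{j\in N}$ of functions that are integrable on $[0,1]$ with $\omega_j\ge 0$ on $[0,1]$,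 $\int_0^1\omega_j(t)\,dt=1$ and $\omega_j(t)=0$ for $t>1$. Start with $M'=M$, $p_{j,o}=0$, supplies $s(o)=1$ and elapsed times $t_j=0$ for all $j,o$. While $M'\ne\emptyset$, perform a round: for each $o\in M'$ let $N_o=\{j\in N:\mathrm{top}_j(M')=o\}$ and let $\rho_o$ be the least element of $$\Big\{\rho\ge 0:\sum_{k\in N_o}\int_{t_k}^{t_k+\rho}\omega_k(t)\,dt=s(o)\Big\}\cup\Big\{\rho\in[0,1]:\sum_{k\in N_o}\int_{t_k}^{t_k+\rho}\omega_k(t)\,dt=\sum_{k\in N_o}\int_{t_k}^{1}\omega_k(t)\,dt\Big\};$$ then for each $o\in M'$ and $j\in N_o$ increase $p_{j,o}$ by $\int_{t_j}^{t_j+\rho_o}\omega_j(t)\,dt$, decrease $s(o)$ by the sum of these amounts over $j\in N_o$, increase $t_j$ by $\rho_o$ for $j\in N_o$, and finally remove from $M'$ all items with $s(o)=0$. When the loop ends, output $\mathrm{PRE}_\omega(R)=(p_{j,o})$. Theorem. For every collection $\omega$ of eating speed functions the algorithm terminates and $\mathrm{PRE}_\omega(R)$ is a random assignment. A random assignment $P$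 satisfies ex-ante FERI if and only if there is a collection $\omega$ of eating speed functions such that $P=\mathrm{PRE}_\omega(R)$. -/

import Mathlib

open MeasureTheory

/-- A preference profile: for every agent `j` a strict linear order on the items;
`R.pref j a b` means that agent `j` strictly prefers `a` to `b`. -/
structure PrefProfile (N M : Type*) where
  pref : N → M → M → Prop
  strict : ∀ j, IsStrictTotalOrder M (pref j)

/-- A random assignment: a doubly stochastic matrix of shares, agents by items. -/
structure IsRandomAssignment {N M : Type*} [Fintype N] [Fintype M] (P : N → M → ℝ) : Prop where
  nonneg : ∀ j o, 0 ≤ P j o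
  row_sum : ∀ j, ∑ o, P j o = 1
  col_sum : ∀ o, ∑ j, P j o = 1

/-- `o` is the item of `S` that agent `j` ranks highest. -/
def IsTopItem {N M : Type*} (R : PrefProfile N M) (j : N) (S : Finset M) (o : M) : Prop :=
  o ∈ S ∧ ∀ o' ∈ S, o' ≠ o → R.pref j o o'

open scoped Classical in
/-- The items that agent `j` weakly prefers to `o`. -/
noncomputable def upperContour {N M : Type*} [Fintype M] (R : PrefProfile N M) (j : N) (o : M) :
    Finset M :=
  {o' | R.pref j o' o ∨ o' = o}

open scoped Classical in
/-- The agents whose top item in `S` is `o` (there are none if `o ∉ S`). -/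
noncomputable def topAgents {N M : Type*} [Fintype N] (R : PrefProfile N M) (S : Finset M)
    (o : M) : Finset N :=
  {j | IsTopItem R j S o}

/-! ### Ex-ante favoring eagerness for remaining items

Rounds are counted from `0`: round `r` here is the `(r + 1)`-st round. -/

open scoped Classical in
/-- The agents that are eager for `o` in some round before round `r`. -/
noncomputable def eagerBefore {N M : Type*} [Fintype N] [Fintype M] (R : PrefProfile N M)
    (P : N → M → ℝ) : ℕ → M → Finset N
  | 0 => fun _ => ∅
  | r + 1 => fun o => eagerBefore R P r o ∪
      topAgents R {o' | ∑ k ∈ eagerBefore R P r o', P k o' < 1} o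

open scoped Classical in
/-- The items whose supply is not used up by the agents eager for them before round `r`. -/
noncomputable def remainingItems {N M : Type*} [Fintype N] [Fintype M] (R : PrefProfile N M)
    (P : N → M → ℝ) (r : ℕ) : Finset M :=
  {o | ∑ k ∈ eagerBefore R P r o, P k o < 1}

/-- The agents that are eager for `o` in round `r`. -/
noncomputable def eagerAgents {N M : Type*} [Fintype N] [Fintype M] (R : PrefProfile N M)
    (P : N → M → ℝ) (r : ℕ) (o : M) : Finset N :=
  topAgents R (remainingItems R P r) o

theorem mem_eagerBefore {N M : Type*} [Fintype N] [Fintype M] (R : PrefProfile N M)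
    (P : N → M → ℝ) (r : ℕ) (o : M) (j : N) :
    j ∈ eagerBefore R P r o ↔ ∃ r' < r, j ∈ eagerAgents R P r' o := by
  classical
  induction r with
  | zero => simp [eagerBefore]
  | succ r ih =>
    have h : eagerBefore R P (r + 1) o = eagerBefore R P r o ∪ eagerAgents R P r o := by
      ext k
      simp only [eagerBefore, eagerAgents, remainingItems, Finset.mem_union]
    rw [h, Finset.mem_union, ih]
    constructor
    · rintro (⟨r', h1, h2⟩ | h2)
      · exact ⟨r', by omega, h2⟩
      · exact ⟨r, by omega, h2⟩
    · rintro ⟨r', h1, h2⟩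
      rcases Nat.lt_succ_iff_lt_or_eq.1 h1 with h3 | rfl
      · exact Or.inl ⟨r', h3, h2⟩
      · exact Or.inr h2

/-- Ex-ante favoring eagerness for remaining items: whenever an item remains in round `r`, all
agents that were eager for it in an earlier round are satisfied by items they weakly prefer
to it. -/
def ExAnteFERI {N M : Type*} [Fintype N] [Fintype M] (R : PrefProfile N M)
    (P : N → M → ℝ) : Prop :=
  ∀ r, ∀ o ∈ remainingItems R P r, ∀ j, (∃ r' < r, j ∈ eagerAgents R P r' o) →
    ∑ o' ∈ upperContour R j o, P j o' = 1

/-! ### The probabilistic respecting eagerness algorithm -/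

/-- An eating speed function. Its values at negative times play no role. -/
structure IsEatingSpeed (w : ℝ → ℝ) : Prop where
  integrable : IntervalIntegrable w volume 0 1
  integral_eq_one : ∫ t in (0 : ℝ)..1, w t = 1
  nonneg : ∀ t ∈ Set.Icc (0 : ℝ) 1, 0 ≤ w t
  eq_zero : ∀ t, 1 < t → w t = 0

/-- The durations after which the agents in `N'`, starting at their elapsed times `t`, have eaten
exactly the supply `s`, or have all together eaten their whole remaining demand. -/
def stoppingTimes {N : Type*} (ω : N → ℝ → ℝ) (N' : Finset N) (t : N → ℝ) (s : ℝ) : Set ℝ :=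
  {ρ | 0 ≤ ρ ∧ ∑ k ∈ N', ∫ x in (t k)..(t k + ρ), ω k x = s} ∪
  {ρ | ρ ∈ Set.Icc (0 : ℝ) 1 ∧
    ∑ k ∈ N', ∫ x in (t k)..(t k + ρ), ω k x = ∑ k ∈ N', ∫ x in (t k)..1, ω k x}

/-- The least stopping time (`isLeast_consumptionTime` shows that the minimum is attained). -/
noncomputable def consumptionTime {N : Type*} (ω : N → ℝ → ℝ) (N' : Finset N) (t : N → ℝ)
    (s : ℝ) : ℝ :=
  sInf (stoppingTimes ω N' t s)

theorem IsEatingSpeed.intervalIntegrable {w : ℝ → ℝ} (h : IsEatingSpeed w) {a b : ℝ}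
    (ha : 0 ≤ a) (hb : 0 ≤ b) : IntervalIntegrable w volume a b := by
  have h1 : ∀ c : ℝ, 0 ≤ c → IntervalIntegrable w volume 0 c := by
    intro c hc
    have h2 : IntervalIntegrable w volume 1 (max 1 c) := by
      refine (IntervalIntegrable.zero (μ := volume) (a := 1) (b := max 1 c)).congr ?_
      intro x hx
      rw [Set.uIoc_of_le (le_max_left _ _)] at hx
      simp [h.eq_zero x hx.1]
    refine (h.integrable.trans h2).mono_set ?_
    rw [Set.uIcc_of_le hc, Set.uIcc_of_le (le_trans zero_le_one (le_max_left _ _))]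
    exact Set.Icc_subset_Icc le_rfl (le_max_right _ _)
  exact (h1 a ha).symm.trans (h1 b hb)

theorem IsEatingSpeed.continuousOn {w : ℝ → ℝ} (h : IsEatingSpeed w) {a : ℝ} (ha : 0 ≤ a) :
    ContinuousOn (fun ρ => ∫ x in a..(a + ρ), w x) (Set.Ici 0) := by
  intro ρ hρ
  have hρ' : (0 : ℝ) ≤ ρ := hρ
  have h1 : ContinuousOn (fun b => ∫ x in a..b, w x) (Set.uIcc a (a + ρ + 1)) :=
    intervalIntegral.continuousOn_primitive_interval
      ((intervalIntegrable_iff').1 (h.intervalIntegrable ha (by positivity)))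
  rw [Set.uIcc_of_le (by linarith)] at h1
  have h2 : ContinuousOn (fun ρ' => ∫ x in a..(a + ρ'), w x) (Set.Icc 0 (ρ + 1)) := by
    refine h1.comp (f := fun ρ' => a + ρ') (by fun_prop) ?_
    intro x hx
    exact ⟨by linarith [hx.1], by linarith [hx.2]⟩
  refine (h2 ρ ⟨hρ', by linarith⟩).mono_of_mem_nhdsWithin ?_
  rw [← Set.Ici_inter_Iic]
  exact Filter.inter_mem self_mem_nhdsWithin
    (mem_nhdsWithin_of_mem_nhds (Iic_mem_nhds (by linarith)))

theorem isLeast_consumptionTime {N : Type*} {ω : N → ℝ → ℝ} (hω : ∀ j, IsEatingSpeed (ω j))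
    (N' : Finset N) {t : N → ℝ} (ht : ∀ j, 0 ≤ t j) (s : ℝ) :
    IsLeast (stoppingTimes ω N' t s) (consumptionTime ω N' t s) := by
  have hc : ContinuousOn (fun ρ => ∑ k ∈ N', ∫ x in (t k)..(t k + ρ), ω k x) (Set.Ici 0) :=
    continuousOn_finsetSum _ fun k _ => (hω k).continuousOn (ht k)
  have hclosed : IsClosed (stoppingTimes ω N' t s) := by
    refine IsClosed.union ?_ ?_
    · exact hc.preimage_isClosed_of_isClosed isClosed_Ici (isClosed_singleton (x := s))
    · exact (hc.mono Set.Icc_subset_Ici_self).preimage_isClosed_of_isClosed isClosed_Icc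
        (isClosed_singleton (x := ∑ k ∈ N', ∫ x in (t k)..1, ω k x))
  have hne : (stoppingTimes ω N' t s).Nonempty := by
    refine ⟨1, Or.inr ⟨by simp, Finset.sum_congr rfl fun k _ => ?_⟩⟩
    have h0 : ∫ x in (1 : ℝ)..(t k + 1), ω k x = 0 := by
      rw [intervalIntegral.integral_of_le (by linarith [ht k])]
      exact setIntegral_eq_zero_of_forall_eq_zero fun x hx => (hω k).eq_zero x hx.1
    rw [← intervalIntegral.integral_add_adjacent_intervals
      ((hω k).intervalIntegrable (ht k) zero_le_one)
      ((hω k).intervalIntegrable zero_le_one (by linarith [ht k])), h0, add_zero]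
  have hbdd : BddBelow (stoppingTimes ω N' t s) := by
    refine ⟨0, ?_⟩
    rintro ρ (h | h)
    · exact h.1
    · exact h.1.1
  exact ⟨hclosed.csInf_mem hne hbdd, fun ρ h => csInf_le hbdd h⟩

/-- The state of the algorithm: the set of available items, the remaining supply of each item,
the elapsed consumption time of each agent, and the shares eaten so far. -/
structure PREState (N M : Type*) where
  available : Finset M
  supply : M → ℝ
  time : N → ℝ
  share : N → M → ℝ

def PREState.init (N M : Type*) [Fintype M] : PREState N M where
  available := Finset.univ
  supply := fun _ => 1
  time := fun _ => 0
  share := fun _ _ => 0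

/-- The duration for which item `o` is eaten in the round that starts in state `σ`. -/
noncomputable def PREState.duration {N M : Type*} [Fintype N] (R : PrefProfile N M)
    (ω : N → ℝ → ℝ) (σ : PREState N M) (o : M) : ℝ :=
  consumptionTime ω (topAgents R σ.available o) σ.time (σ.supply o)

/-- The amount of `o` eaten in the round that starts in state `σ` by agent `j`, if `o` is the top
available item of `j`. -/
noncomputable def PREState.amount {N M : Type*} [Fintype N] (R : PrefProfile N M)
    (ω : N → ℝ → ℝ) (σ : PREState N M) (j : N) (o : M) : ℝ :=
  ∫ x in (σ.time j)..(σ.time j + σ.duration R ω o), ω j x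

/-- The supply left after the round that starts in state `σ`. -/
noncomputable def PREState.nextSupply {N M : Type*} [Fintype N] (R : PrefProfile N M)
    (ω : N → ℝ → ℝ) (σ : PREState N M) (o : M) : ℝ :=
  σ.supply o - ∑ k ∈ topAgents R σ.available o, σ.amount R ω k o

open scoped Classical in
/-- One round: every agent eats her top available item, all agents eating the same item for the
same duration; then the exhausted items are removed. The sum in `time` has at most one nonzero
term, that of the item that `j` eats. -/
noncomputable def PREState.step {N M : Type*} [Fintype N] (R : PrefProfile N M)
    (ω : N → ℝ → ℝ) (σ : PREState N M) : PREState N M where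
  available := {o ∈ σ.available | σ.nextSupply R ω o ≠ 0}
  supply := σ.nextSupply R ω
  time := fun j => σ.time j +
    ∑ o ∈ σ.available, if j ∈ topAgents R σ.available o then σ.duration R ω o else 0
  share := fun j o => σ.share j o +
    if j ∈ topAgents R σ.available o then σ.amount R ω j o else 0

/-- The state after `r` rounds. -/
noncomputable def preState {N M : Type*} [Fintype N] [Fintype M] (R : PrefProfile N M)
    (ω : N → ℝ → ℝ) (r : ℕ) : PREState N M :=
  (PREState.step R ω)^[r] (PREState.init N M)

/-- The loop ends: at some point no item is available any more. -/
def PREHalts {N M : Type*} [Fintype N] [Fintype M] (R : PrefProfile N M)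
    (ω : N → ℝ → ℝ) : Prop :=
  ∃ r, (preState R ω r).available = ∅

open scoped Classical in
/-- The output of the algorithm: the shares when the loop ends (and `0` if it does not end). -/
noncomputable def PRE {N M : Type*} [Fintype N] [Fintype M] (R : PrefProfile N M)
    (ω : N → ℝ → ℝ) : N → M → ℝ :=
  if h : PREHalts R ω then (preState R ω (Nat.find h)).share else 0

/-! After each round of the algorithm the shares determine supplies, demands and available items
(`PREState.Consistent`). An item that survives a round leaves all its eaters sated; hence some item
runs out in every round, since otherwise all `|N| = |M|` units would be eaten.

For the output, satedness also freezes the shares of those eaters. So the items remaining in the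
FERI recursion are exactly the available ones, round by round (`remainingItems_PRE`), and an agent
who ate a surviving item holds only items she weakly prefers to it (`PRE_exAnteFERI`).

Conversely, given a FERI assignment `P`, cut `[0,1]` into `|M|` equal intervals and let each agent
eat in the `r`-th one, at constant speed, what she newly gets in round `r` of the recursion
(`feriSpeed`). An item that runs out is then eaten for exactly one interval, which keeps its eaters
synchronised. Eaters of a surviving item may lose synchrony, but by FERI they are sated and their
clocks no longer matter. Induction on rounds (`PREState.Follows.step`) shows that the algorithm
reproduces `P`. -/

/-! ### Eating speeds and consumption times -/

section EatingSpeed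

variable {w : ℝ → ℝ}

theorem IsEatingSpeed.nonneg_of_nonneg (h : IsEatingSpeed w) {x : ℝ} (hx : 0 ≤ x) : 0 ≤ w x := by
  rcases le_or_gt x 1 with h1 | h1
  · exact h.nonneg x ⟨hx, h1⟩
  · exact (h.eq_zero x h1).ge

theorem IsEatingSpeed.integral_nonneg (h : IsEatingSpeed w) {t ρ : ℝ} (ht : 0 ≤ t) (hρ : 0 ≤ ρ) :
    0 ≤ ∫ x in t..(t + ρ), w x :=
  intervalIntegral.integral_nonneg (by linarith) fun x hx =>
    h.nonneg_of_nonneg (ht.trans hx.1)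

/-- The demand remaining at time `t` is nonnegative. -/
theorem IsEatingSpeed.demand_nonneg (h : IsEatingSpeed w) {t : ℝ} (ht : 0 ≤ t) :
    0 ≤ ∫ x in t..1, w x := by
  rcases le_total t 1 with h1 | h1
  · exact intervalIntegral.integral_nonneg h1 fun x hx => h.nonneg_of_nonneg (ht.trans hx.1)
  · rw [intervalIntegral.integral_symm, intervalIntegral.integral_of_le h1,
      setIntegral_eq_zero_of_forall_eq_zero fun x hx => h.eq_zero x hx.1, neg_zero]

theorem IsEatingSpeed.integral_add_demand (h : IsEatingSpeed w) {t ρ : ℝ} (ht : 0 ≤ t)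
    (hρ : 0 ≤ ρ) :
    (∫ x in t..(t + ρ), w x) + ∫ x in (t + ρ)..1, w x = ∫ x in t..1, w x :=
  intervalIntegral.integral_add_adjacent_intervals
    (h.intervalIntegrable ht (by positivity)) (h.intervalIntegrable (by positivity) zero_le_one)

end EatingSpeed

/-- At the consumption time, either the supply is used up or everyone's demand is. -/
theorem consumptionTime_spec {N : Type*} {ω : N → ℝ → ℝ} (hω : ∀ j, IsEatingSpeed (ω j))
    (N' : Finset N) {t : N → ℝ} (ht : ∀ j, 0 ≤ t j) {s : ℝ} (hs : 0 ≤ s) :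
    0 ≤ consumptionTime ω N' t s ∧
    ∑ k ∈ N', ∫ x in (t k)..(t k + consumptionTime ω N' t s), ω k x ≤ s ∧
    (∑ k ∈ N', ∫ x in (t k)..(t k + consumptionTime ω N' t s), ω k x = s ∨
      ∀ k ∈ N', ∫ x in (t k + consumptionTime ω N' t s)..1, ω k x = 0) := by
  obtain ⟨hmem, hleast⟩ := isLeast_consumptionTime hω N' ht s
  set ρ := consumptionTime ω N' t s
  have hρ : 0 ≤ ρ := by rcases hmem with h | h; exacts [h.1, h.1.1]
  refine ⟨hρ, ?_, ?_⟩
  -- Consumption is continuous and starts at `0 ≤ s`, so overshooting `s` would mean that `s` was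
  -- hit at an earlier stopping time.
  · by_contra! hlt
    have hc : ContinuousOn (fun ρ => ∑ k ∈ N', ∫ x in (t k)..(t k + ρ), ω k x) (Set.Icc 0 ρ) :=
      (continuousOn_finsetSum _ fun k _ => (hω k).continuousOn (ht k)).mono Set.Icc_subset_Ici_self
    obtain ⟨ρ', h1, h2⟩ := intermediate_value_Icc hρ hc (show s ∈ Set.Icc _ _ from
      ⟨by simpa using hs, hlt.le⟩)
    have h3 : ρ ≤ ρ' := hleast (Or.inl ⟨h1.1, h2⟩)
    obtain rfl : ρ' = ρ := le_antisymm h1.2 h3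
    exact hlt.ne' h2
  · rcases hmem with h | h
    · exact Or.inl h.2
    · right
      have h0 : ∑ k ∈ N', ∫ x in (t k + ρ)..1, ω k x = 0 := by
        have h1 := h.2
        rw [← sub_eq_zero, ← neg_eq_zero, neg_sub, ← Finset.sum_sub_distrib] at h1
        rw [← h1]
        refine Finset.sum_congr rfl fun k _ => ?_
        rw [← (hω k).integral_add_demand (ht k) hρ]; ring
      exact (Finset.sum_eq_zero_iff_of_nonneg fun k _ =>
        (hω k).demand_nonneg (add_nonneg (ht k) hρ)).1 h0

/-! ### Top items -/

section TopItem

variable {N M : Type*} {R : PrefProfile N M} {j : N} {S T : Finset M} {o o' : M}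

theorem PrefProfile.asymm (R : PrefProfile N M) (j : N) {a b : M} (h : R.pref j a b)
    (h' : R.pref j b a) : False := by
  have := R.strict j
  exact asymm_of (R.pref j) h h'

theorem IsTopItem.eq (h : IsTopItem R j S o) (h' : IsTopItem R j S o') : o' = o := by
  by_contra hne
  exact R.asymm j (h.2 o' h'.1 hne) (h'.2 o h.1 (Ne.symm hne))

theorem exists_isTopItem (R : PrefProfile N M) (j : N) (hS : S.Nonempty) :
    ∃ o, IsTopItem R j S o := by
  classical
  have := R.strict j
  induction hS using Finset.Nonempty.cons_induction with
  | singleton a => exact ⟨a, by simp [IsTopItem]⟩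
  | cons a s ha hs ih =>
    obtain ⟨o, ho, htop⟩ := ih
    rcases trichotomous_of (R.pref j) a o with h | h | h
    · refine ⟨a, by simp, fun o' ho' hne => ?_⟩
      rcases Finset.mem_cons.1 ho' with rfl | h1
      · exact absurd rfl hne
      · by_cases h2 : o' = o
        · exact h2 ▸ h
        · exact trans_of (R.pref j) h (htop o' h1 h2)
    · exact absurd (h ▸ ho) ha
    · refine ⟨o, by simp [ho], fun o' ho' hne => ?_⟩
      rcases Finset.mem_cons.1 ho' with rfl | h1
      · exact h
      · exact htop o' h1 hne

theorem mem_topAgents [Fintype N] : j ∈ topAgents R S o ↔ IsTopItem R j S o := by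
  simp [topAgents]

theorem topAgents_empty [Fintype N] : topAgents R ∅ o = ∅ :=
  Finset.eq_empty_of_forall_notMem fun j hj => by simpa using (mem_topAgents.1 hj).1

theorem mem_upperContour [Fintype M] : o' ∈ upperContour R j o ↔ R.pref j o' o ∨ o' = o := by
  simp [upperContour]

theorem IsTopItem.mem_upperContour [Fintype M] (h : IsTopItem R j S o') (ho : o ∈ S) :
    o' ∈ upperContour R j o := by
  rw [_root_.mem_upperContour]
  by_cases h1 : o = o'
  · exact Or.inr h1.symm
  · exact Or.inl (h.2 o ho h1)

end TopItem

/-! ### One round of the algorithm and its invariant -/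

namespace PREState

variable {N M : Type*} [Fintype N] {R : PrefProfile N M} {ω : N → ℝ → ℝ}
  {σ : PREState N M}

/-- Makes the iteration stationary after halting, so that the output can be read off at any later
round. -/
theorem step_eq_self (h : σ.available = ∅) : σ.step R ω = σ := by
  have h2 : ∀ o, topAgents R σ.available o = ∅ := fun o => by rw [h, topAgents_empty]
  have h3 : σ.nextSupply R ω = σ.supply := funext fun o => by simp [nextSupply, h2]
  simp only [step, h3, h, topAgents_empty]
  cases σ
  simp_all

theorem step_available_subset : (σ.step R ω).available ⊆ σ.available :=
  Finset.filter_subset _ _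

theorem step_share_of_mem {j : N} {o : M} (h : j ∈ topAgents R σ.available o) :
    (σ.step R ω).share j o = σ.share j o + σ.amount R ω j o := by
  simp [step, h]

theorem step_share_of_notMem {j : N} {o : M} (h : j ∉ topAgents R σ.available o) :
    (σ.step R ω).share j o = σ.share j o := by
  simp [step, h]

theorem step_time_of_mem {j : N} {o : M} (h : j ∈ topAgents R σ.available o) :
    (σ.step R ω).time j = σ.time j + σ.duration R ω o := by
  classical
  have ho := mem_topAgents.1 h
  simp only [step]
  rw [Finset.sum_eq_single o, if_pos h]
  · intro o' _ hne
    rw [if_neg]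
    exact fun h' => hne (ho.eq (mem_topAgents.1 h'))
  · exact fun h' => absurd ho.1 h'

theorem step_col_sum (o : M) :
    ∑ j, (σ.step R ω).share j o =
      ∑ j, σ.share j o + ∑ j ∈ topAgents R σ.available o, σ.amount R ω j o := by
  classical
  simp only [step]
  rw [Finset.sum_add_distrib, Finset.sum_ite_mem, Finset.univ_inter]

theorem exists_mem_topAgents (R : PrefProfile N M) (h : σ.available ≠ ∅) (j : N) :
    ∃ o, j ∈ topAgents R σ.available o := by
  obtain ⟨o, ho⟩ := exists_isTopItem R j (Finset.nonempty_iff_ne_empty.2 h)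
  exact ⟨o, mem_topAgents.2 ho⟩

variable [Fintype M]

theorem step_row_sum_of_mem {j : N} {o : M} (h : j ∈ topAgents R σ.available o) :
    ∑ o', (σ.step R ω).share j o' = ∑ o', σ.share j o' + σ.amount R ω j o := by
  classical
  simp only [step]
  rw [Finset.sum_add_distrib, add_right_inj, Finset.sum_eq_single o, if_pos h]
  · intro o' _ hne
    rw [if_neg]
    exact fun h' => hne ((mem_topAgents.1 h).eq (mem_topAgents.1 h'))
  · exact fun h' => absurd (Finset.mem_univ o) h'

/-- The invariant of the algorithm: supplies, demands and available items are the ones determined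
by the shares eaten so far. -/
structure Consistent (ω : N → ℝ → ℝ) (σ : PREState N M) : Prop where
  time_nonneg : ∀ j, 0 ≤ σ.time j
  share_nonneg : ∀ j o, 0 ≤ σ.share j o
  supply_nonneg : ∀ o, 0 ≤ σ.supply o
  supply_eq : ∀ o, σ.supply o = 1 - ∑ j, σ.share j o
  demand_eq : ∀ j, ∫ x in (σ.time j)..1, ω j x = 1 - ∑ o, σ.share j o
  mem_available : ∀ o, o ∈ σ.available ↔ σ.supply o ≠ 0

theorem consistent_init (hω : ∀ j, IsEatingSpeed (ω j)) : (init N M).Consistent ω where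
  time_nonneg := by simp [init]
  share_nonneg := by simp [init]
  supply_nonneg := by simp [init]
  supply_eq := by simp [init]
  demand_eq := fun j => by simp [init, (hω j).integral_eq_one]
  mem_available := by simp [init]

theorem Consistent.row_sum_le (h : σ.Consistent ω) (hω : ∀ j, IsEatingSpeed (ω j)) (j : N) :
    ∑ o, σ.share j o ≤ 1 := by
  have h1 := (hω j).demand_nonneg (h.time_nonneg j)
  rw [h.demand_eq] at h1
  linarith

theorem Consistent.duration_nonneg (h : σ.Consistent ω) (hω : ∀ j, IsEatingSpeed (ω j)) (o : M) :
    0 ≤ σ.duration R ω o :=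
  (consumptionTime_spec hω _ h.time_nonneg (h.supply_nonneg o)).1

theorem Consistent.amount_nonneg (h : σ.Consistent ω) (hω : ∀ j, IsEatingSpeed (ω j))
    (j : N) (o : M) : 0 ≤ σ.amount R ω j o :=
  (hω j).integral_nonneg (h.time_nonneg j) (h.duration_nonneg hω o)

theorem Consistent.share_le_step (h : σ.Consistent ω) (hω : ∀ j, IsEatingSpeed (ω j))
    (j : N) (o : M) : σ.share j o ≤ (σ.step R ω).share j o := by
  by_cases hj : j ∈ topAgents R σ.available o
  · rw [step_share_of_mem hj]
    linarith [h.amount_nonneg (R := R) hω j o]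
  · rw [step_share_of_notMem hj]

/-- While items are available, each agent eats exactly one of them, so her elapsed time and her row
sum each change by a single term. -/
theorem Consistent.step (h : σ.Consistent ω) (hω : ∀ j, IsEatingSpeed (ω j)) :
    (σ.step R ω).Consistent ω := by
  by_cases hne : σ.available = ∅
  · rwa [step_eq_self hne]
  have hsupply : ∀ o, 0 ≤ (σ.step R ω).supply o := fun o =>
    sub_nonneg.2 (consumptionTime_spec hω _ h.time_nonneg (h.supply_nonneg o)).2.1
  refine ⟨fun j => ?_, fun j o => (h.share_nonneg j o).trans (h.share_le_step hω j o), hsupply,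
    fun o => ?_, fun j => ?_, fun o => ?_⟩
  · obtain ⟨o, ho⟩ := exists_mem_topAgents R hne j
    rw [step_time_of_mem ho]
    exact add_nonneg (h.time_nonneg j) (h.duration_nonneg hω o)
  · rw [step_col_sum, ← sub_sub, ← h.supply_eq]
    rfl
  · obtain ⟨o, ho⟩ := exists_mem_topAgents R hne j
    rw [step_time_of_mem ho, step_row_sum_of_mem ho, ← sub_sub, ← h.demand_eq,
      ← (hω j).integral_add_demand (h.time_nonneg j) (h.duration_nonneg hω o (R := R)), amount]
    ring
  · have h1 : o ∈ (σ.step R ω).available ↔ o ∈ σ.available ∧ (σ.step R ω).supply o ≠ 0 := by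
      simp [PREState.step]
    rw [h1, and_iff_right_iff_imp]
    -- Supplies never increase and stay nonnegative, so an exhausted item stays exhausted.
    intro h2
    rw [h.mem_available]
    intro h3
    refine h2 (le_antisymm ?_ (hsupply o))
    have h4 : (σ.step R ω).supply o =
      σ.supply o - ∑ k ∈ topAgents R σ.available o, σ.amount R ω k o := rfl
    rw [h4, h3, zero_sub, neg_nonpos]
    exact Finset.sum_nonneg fun k _ => h.amount_nonneg hω k o

/-- If an item survives a round, then all agents who ate it in that round are sated. -/
theorem Consistent.row_sum_step_eq_one (h : σ.Consistent ω) (hω : ∀ j, IsEatingSpeed (ω j))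
    {j : N} {o : M} (hj : j ∈ topAgents R σ.available o) (ho : o ∈ (σ.step R ω).available) :
    ∑ o', (σ.step R ω).share j o' = 1 := by
  have h1 := ((h.step hω (R := R)).mem_available o).1 ho
  have h2 : (σ.step R ω).supply o =
      σ.supply o - ∑ k ∈ topAgents R σ.available o, σ.amount R ω k o := rfl
  rcases (consumptionTime_spec hω (topAgents R σ.available o) h.time_nonneg
    (h.supply_nonneg o)).2.2 with h3 | h3
  · exact absurd (h2.trans (sub_eq_zero.2 h3.symm)) h1
  · have h4 := (h.step hω (R := R)).demand_eq j
    rw [step_time_of_mem hj, duration, h3 j hj] at h4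
    linarith

/-- If no item ran out, every agent would have eaten a surviving item and be sated; the `|N| = |M|`
units eaten would leave total supply zero. -/
theorem Consistent.card_step_available_lt (hcard : Fintype.card N = Fintype.card M)
    (h : σ.Consistent ω) (hω : ∀ j, IsEatingSpeed (ω j)) (hne : σ.available ≠ ∅) :
    (σ.step R ω).available.card < σ.available.card := by
  refine Finset.card_lt_card (step_available_subset.ssubset_of_ne fun heq => hne ?_)
  have h' := h.step hω (R := R)
  have h1 : ∀ j, ∑ o, (σ.step R ω).share j o = 1 := fun j => by
    obtain ⟨o, ho⟩ := exists_mem_topAgents R hne j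
    exact h.row_sum_step_eq_one hω ho (heq ▸ (mem_topAgents.1 ho).1)
  have h2 : ∑ o, (σ.step R ω).supply o = 0 := by
    simp_rw [h'.supply_eq]
    rw [Finset.sum_sub_distrib, Finset.sum_comm]
    simp [h1, hcard]
  rw [Finset.sum_eq_zero_iff_of_nonneg fun o _ => h'.supply_nonneg o] at h2
  rw [← heq]
  refine Finset.eq_empty_of_forall_notMem fun o ho => ?_
  exact (h'.mem_available o).1 ho (h2 o (Finset.mem_univ o))

end PREState

/-! ### The whole run: termination, and FERI of the output -/

section Run

variable {N M : Type*} [Fintype N] [Fintype M] {R : PrefProfile N M} {ω : N → ℝ → ℝ}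

theorem preState_succ (R : PrefProfile N M) (ω : N → ℝ → ℝ) (r : ℕ) :
    preState R ω (r + 1) = (preState R ω r).step R ω :=
  Function.iterate_succ_apply' _ _ _

theorem preState_consistent (R : PrefProfile N M) (hω : ∀ j, IsEatingSpeed (ω j)) (r : ℕ) :
    (preState R ω r).Consistent ω := by
  induction r with
  | zero => exact PREState.consistent_init hω
  | succ r ih => rw [preState_succ]; exact ih.step hω

theorem preState_available_antitone (R : PrefProfile N M) (ω : N → ℝ → ℝ) :
    Antitone fun r => (preState R ω r).available :=
  antitone_nat_of_succ_le fun r => by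
    rw [preState_succ]; exact PREState.step_available_subset

theorem preState_share_monotone (R : PrefProfile N M) (hω : ∀ j, IsEatingSpeed (ω j)) (j : N)
    (o : M) : Monotone fun r => (preState R ω r).share j o :=
  monotone_nat_of_le_succ fun r => by
    rw [preState_succ]; exact (preState_consistent R hω r).share_le_step hω j o

theorem preState_available_card (hcard : Fintype.card N = Fintype.card M)
    (R : PrefProfile N M) (hω : ∀ j, IsEatingSpeed (ω j)) :
    (preState R ω (Fintype.card M)).available = ∅ := by
  have h : ∀ r, (preState R ω r).available.card ≤ Fintype.card M - r := by
    intro r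
    induction r with
    | zero => exact Finset.card_le_univ _
    | succ r ih =>
      rw [preState_succ]
      by_cases hne : (preState R ω r).available = ∅
      · rw [PREState.step_eq_self hne, hne]; simp
      · have := (preState_consistent R hω r).card_step_available_lt (R := R) hcard hω hne
        omega
  simpa using h (Fintype.card M)

theorem preState_eq_of_available_eq_empty {r s : ℕ} (h : (preState R ω r).available = ∅)
    (hrs : r ≤ s) : preState R ω s = preState R ω r := by
  induction s, hrs using Nat.le_induction with
  | base => rfl
  | succ s _ ih => rw [preState_succ, ih, PREState.step_eq_self h]

/-- Replaces the unknown halting round by the fixed round `|M|`. -/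
theorem PRE_eq_share (hcard : Fintype.card N = Fintype.card M)
    (R : PrefProfile N M) (hω : ∀ j, IsEatingSpeed (ω j)) :
    PRE R ω = (preState R ω (Fintype.card M)).share := by
  classical
  have h : PREHalts R ω := ⟨_, preState_available_card hcard R hω⟩
  rw [PRE, dif_pos h, preState_eq_of_available_eq_empty (Nat.find_spec h)
    (Nat.find_min' h (preState_available_card hcard R hω))]

theorem share_le_PRE (hcard : Fintype.card N = Fintype.card M)
    (R : PrefProfile N M) (hω : ∀ j, IsEatingSpeed (ω j)) (r : ℕ) (j : N) (o : M) :
    (preState R ω r).share j o ≤ PRE R ω j o := by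
  rw [PRE_eq_share hcard R hω]
  refine (preState_share_monotone R hω j o (le_max_left r (Fintype.card M))).trans ?_
  dsimp only
  rw [preState_eq_of_available_eq_empty (preState_available_card hcard R hω) (le_max_right _ _)]

/-- Columns are full because no item is available at the end. Rows are at most `1` and their total
is `|M| = |N|`, so each is exactly `1`. -/
theorem PRE_isRandomAssignment (hcard : Fintype.card N = Fintype.card M)
    (R : PrefProfile N M) (hω : ∀ j, IsEatingSpeed (ω j)) : IsRandomAssignment (PRE R ω) := by
  rw [PRE_eq_share hcard R hω]
  have h := preState_consistent R hω (Fintype.card M)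
  have hcol : ∀ o, ∑ j, (preState R ω (Fintype.card M)).share j o = 1 := fun o => by
    have h1 : (preState R ω (Fintype.card M)).supply o = 0 := by
      by_contra h2
      have h3 := (h.mem_available o).2 h2
      simp [preState_available_card hcard R hω] at h3
    rw [h.supply_eq] at h1
    linarith
  refine ⟨h.share_nonneg, fun j => ?_, hcol⟩
  have h1 : ∑ j, (1 - ∑ o, (preState R ω (Fintype.card M)).share j o) = 0 := by
    rw [Finset.sum_sub_distrib, Finset.sum_comm]
    simp [hcol, hcard]
  rw [Finset.sum_eq_zero_iff_of_nonneg fun j _ => sub_nonneg.2 (h.row_sum_le hω j)] at h1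
  linarith [h1 j (Finset.mem_univ j)]

theorem exists_mem_topAgents_of_share_ne_zero {r : ℕ} {j : N} {o : M}
    (h : (preState R ω r).share j o ≠ 0) :
    ∃ r' < r, j ∈ topAgents R (preState R ω r').available o := by
  induction r with
  | zero => exact absurd rfl h
  | succ r ih =>
    by_cases hj : j ∈ topAgents R (preState R ω r).available o
    · exact ⟨r, r.lt_succ_self, hj⟩
    · rw [preState_succ, PREState.step_share_of_notMem hj] at h
      obtain ⟨r', h1, h2⟩ := ih h
      exact ⟨r', by omega, h2⟩

/-- Once an agent has eaten an item without exhausting it, her shares are final. -/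
theorem PRE_eq_of_survives (hcard : Fintype.card N = Fintype.card M)
    (hω : ∀ j, IsEatingSpeed (ω j)) {r r' : ℕ} {j : N} {o : M} (hr : r' < r)
    (hj : j ∈ topAgents R (preState R ω r').available o)
    (ho : o ∈ (preState R ω r).available) (o' : M) :
    PRE R ω j o' = (preState R ω (r' + 1)).share j o' := by
  have h1 : ∑ o', (preState R ω (r' + 1)).share j o' = 1 := by
    have h2 : o ∈ (preState R ω (r' + 1)).available :=
      preState_available_antitone R ω (Nat.succ_le_of_lt hr) ho
    rw [preState_succ] at h2 ⊢
    exact (preState_consistent R hω r').row_sum_step_eq_one hω hj h2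
  have h3 := (PRE_isRandomAssignment hcard R hω).row_sum j
  -- Shares only grow, and the row sum is already `1`: no entry can change.
  exact ((Finset.sum_eq_sum_iff_of_le fun o' _ => share_le_PRE hcard R hω (r' + 1) j o').1
    (h1.trans h3.symm) o' (Finset.mem_univ o')).symm

/-- By strong induction, the agents eager for an item before round `r` are those who have eaten it.
If it has run out, they already hold all of it. If it survives, their shares are final, so what they
hold in the output is still `1` minus the positive current supply. -/
theorem remainingItems_PRE (hcard : Fintype.card N = Fintype.card M)
    (R : PrefProfile N M) (hω : ∀ j, IsEatingSpeed (ω j)) (r : ℕ) :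
    remainingItems R (PRE R ω) r = (preState R ω r).available := by
  induction r using Nat.strong_induction_on with
  | _ r ih =>
  have hmem : ∀ j o, j ∈ eagerBefore R (PRE R ω) r o ↔
      ∃ r' < r, j ∈ topAgents R (preState R ω r').available o := fun j o => by
    rw [mem_eagerBefore]
    refine exists_congr fun r' => and_congr_right fun hr => ?_
    rw [eagerAgents, ih r' hr]
  have hc := preState_consistent R hω r
  have hsum : ∀ o, ∑ k ∈ eagerBefore R (PRE R ω) r o, (preState R ω r).share k o =
      1 - (preState R ω r).supply o := fun o => by
    rw [hc.supply_eq, sub_sub_cancel]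
    refine Finset.sum_subset (Finset.subset_univ _) fun k _ hk => ?_
    by_contra h
    exact hk ((hmem k o).2 (exists_mem_topAgents_of_share_ne_zero h))
  ext o
  rw [remainingItems, Finset.mem_filter_univ]
  constructor
  · intro h
    rw [hc.mem_available]
    intro h0
    have h1 := Finset.sum_le_sum fun k (_ : k ∈ eagerBefore R (PRE R ω) r o) =>
      share_le_PRE hcard R hω r k o
    rw [hsum, h0] at h1
    linarith
  · intro h
    have h1 : ∑ k ∈ eagerBefore R (PRE R ω) r o, PRE R ω k o =
        1 - (preState R ω r).supply o := by
      rw [← hsum]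
      refine Finset.sum_congr rfl fun k hk => le_antisymm ?_ (share_le_PRE hcard R hω r k o)
      obtain ⟨r', hr, hk'⟩ := (hmem k o).1 hk
      rw [PRE_eq_of_survives hcard hω hr hk' h]
      exact preState_share_monotone R hω k o hr
    have h2 := (hc.supply_nonneg o).lt_of_ne' ((hc.mem_available o).1 h)
    linarith

/-- Anything `j` owns was eaten no later than round `r'`, when `o` was still available; being her
top item then, it is weakly better than `o`. -/
theorem PRE_exAnteFERI (hcard : Fintype.card N = Fintype.card M)
    (R : PrefProfile N M) (hω : ∀ j, IsEatingSpeed (ω j)) : ExAnteFERI R (PRE R ω) := by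
  rintro r o ho j ⟨r', hr, hj⟩
  rw [eagerAgents, remainingItems_PRE hcard R hω] at hj
  rw [remainingItems_PRE hcard R hω] at ho
  rw [← (PRE_isRandomAssignment hcard R hω).row_sum j]
  refine Finset.sum_subset (Finset.subset_univ _) fun o' _ ho' => ?_
  by_contra h
  rw [PRE_eq_of_survives hcard hω hr hj ho] at h
  obtain ⟨r'', hr'', hj''⟩ := exists_mem_topAgents_of_share_ne_zero h
  exact ho' ((mem_topAgents.1 hj'').mem_upperContour
    (preState_available_antitone R ω (Nat.le_of_lt_succ hr'') (mem_topAgents.1 hj).1))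

end Run

/-! ### Piecewise constant eating speeds -/

section StepSpeed

/-- The eating speed function that eats the amount `f r` at constant speed in the `r`-th of `n`
time intervals of equal length. -/
noncomputable def stepSpeed (n : ℕ) (f : ℕ → ℝ) (t : ℝ) : ℝ := n * f (⌈n * t⌉₊ - 1)

variable {n : ℕ} {f : ℕ → ℝ}

/-- The intervals are open on the left, matching both the ceiling and the convention of `Set.uIoc`;
no endpoint needs separate treatment under the integral. -/
theorem stepSpeed_eq (hn : 0 < n) (r : ℕ) {x : ℝ} (h1 : (r : ℝ) / n < x) (h2 : x ≤ (r + 1) / n) :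
    stepSpeed n f x = n * f r := by
  have hn' : (0 : ℝ) < n := by exact_mod_cast hn
  rw [div_lt_iff₀ hn'] at h1
  rw [le_div_iff₀ hn'] at h2
  have h : ⌈(n : ℝ) * x⌉₊ = r + 1 := by
    rw [Nat.ceil_eq_iff r.succ_ne_zero, Nat.succ_sub_one]
    push_cast
    constructor <;> linarith
  rw [stepSpeed, h, Nat.add_sub_cancel]

theorem stepSpeed_eqOn (hn : 0 < n) (r : ℕ) {ρ : ℝ} (h0 : 0 ≤ ρ) (h1 : ρ ≤ 1 / n) :
    Set.EqOn (fun _ => n * f r) (stepSpeed n f) (Set.uIoc ((r : ℝ) / n) (r / n + ρ)) := by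
  intro x hx
  rw [Set.uIoc_of_le (by linarith)] at hx
  refine (stepSpeed_eq hn r hx.1 ?_).symm
  rw [add_div]
  linarith [hx.2]

theorem integral_stepSpeed (hn : 0 < n) (r : ℕ) {ρ : ℝ} (h0 : 0 ≤ ρ) (h1 : ρ ≤ 1 / n) :
    ∫ x in ((r : ℝ) / n)..(r / n + ρ), stepSpeed n f x = n * ρ * f r := by
  rw [← intervalIntegral.integral_congr_ae (Filter.Eventually.of_forall
    (stepSpeed_eqOn hn r h0 h1)), intervalIntegral.integral_const, smul_eq_mul]
  ring

theorem isEatingSpeed_stepSpeed (hn : 0 < n) (h0 : ∀ r, 0 ≤ f r)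
    (h1 : ∑ r ∈ Finset.range n, f r = 1) (h2 : ∀ r, n ≤ r → f r = 0) :
    IsEatingSpeed (stepSpeed n f) := by
  have hn' : (0 : ℝ) < n := by exact_mod_cast hn
  have hadd : ∀ r : ℕ, (r : ℝ) / n + 1 / n = ((r + 1 : ℕ) : ℝ) / n := fun r => by
    push_cast; ring
  have hint : ∀ r < n, IntervalIntegrable (stepSpeed n f) volume ((r : ℝ) / n)
      ((r + 1 : ℕ) / n) := fun r _ => by
    have h := stepSpeed_eqOn (f := f) hn r (by positivity) le_rfl
    rw [hadd] at h
    exact intervalIntegrable_const.congr h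
  refine ⟨?_, ?_, fun t _ => mul_nonneg hn'.le (h0 _), fun t ht => ?_⟩
  · have h := IntervalIntegrable.trans_iterate (a := fun r : ℕ => (r : ℝ) / n) hint
    simpa [hn'.ne'] using h
  · have h := intervalIntegral.sum_integral_adjacent_intervals
      (a := fun r : ℕ => (r : ℝ) / n) hint
    simp only [Nat.cast_zero, zero_div, div_self hn'.ne'] at h
    rw [← h, ← h1]
    refine Finset.sum_congr rfl fun r _ => ?_
    rw [← hadd, integral_stepSpeed hn r (by positivity) le_rfl]
    field_simp
  · have h : n < ⌈(n : ℝ) * t⌉₊ := Nat.lt_ceil.2 (by nlinarith)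
    rw [stepSpeed, h2 _ (by omega), mul_zero]

end StepSpeed

/-! ### Structure of the FERI recursion -/

section Eager

variable {N M : Type*} [Fintype N] [Fintype M] {R : PrefProfile N M} {P : N → M → ℝ}

open scoped Classical in
/-- The share of `o` that agent `j` gets by being eager for it before round `r`. -/
noncomputable def eagerShare (R : PrefProfile N M) (P : N → M → ℝ) (r : ℕ) (j : N) (o : M) : ℝ :=
  if j ∈ eagerBefore R P r o then P j o else 0

/-- The share that agent `j` gets by being eager for an item for the first time in round `r`. -/
noncomputable def roundShare (R : PrefProfile N M) (P : N → M → ℝ) (j : N) (r : ℕ) : ℝ :=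
  ∑ o, (eagerShare R P (r + 1) j o - eagerShare R P r j o)

theorem eagerShare_of_mem {r : ℕ} {j : N} {o : M} (h : j ∈ eagerBefore R P r o) :
    eagerShare R P r j o = P j o := if_pos h

theorem eagerShare_of_notMem {r : ℕ} {j : N} {o : M} (h : j ∉ eagerBefore R P r o) :
    eagerShare R P r j o = 0 := if_neg h

theorem sum_eagerShare (r : ℕ) (o : M) :
    ∑ j, eagerShare R P r j o = ∑ j ∈ eagerBefore R P r o, P j o := by
  classical
  simp only [eagerShare]
  rw [Finset.sum_ite_mem, Finset.univ_inter]

theorem mem_remainingItems {r : ℕ} {o : M} :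
    o ∈ remainingItems R P r ↔ ∑ j, eagerShare R P r j o < 1 := by
  rw [sum_eagerShare, remainingItems, Finset.mem_filter_univ]

theorem mem_eagerBefore_succ {r : ℕ} {j : N} {o : M} :
    j ∈ eagerBefore R P (r + 1) o ↔ j ∈ eagerBefore R P r o ∨ j ∈ eagerAgents R P r o := by
  simp only [mem_eagerBefore]
  constructor
  · rintro ⟨r', h1, h2⟩
    rcases Nat.lt_succ_iff_lt_or_eq.1 h1 with h3 | rfl
    exacts [Or.inl ⟨r', h3, h2⟩, Or.inr h2]
  · rintro (⟨r', h1, h2⟩ | h2)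
    exacts [⟨r', by omega, h2⟩, ⟨r, by omega, h2⟩]

theorem eagerShare_succ_of_notMem {r : ℕ} {j : N} {o : M} (h : j ∉ eagerAgents R P r o) :
    eagerShare R P (r + 1) j o = eagerShare R P r j o := by
  classical
  simp only [eagerShare, mem_eagerBefore_succ, or_iff_left h]

theorem sum_range_roundShare (j : N) (r : ℕ) :
    ∑ r' ∈ Finset.range r, roundShare R P j r' = ∑ o, eagerShare R P r j o := by
  have h : ∀ r', roundShare R P j r' =
      ∑ o, eagerShare R P (r' + 1) j o - ∑ o, eagerShare R P r' j o := fun r' =>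
    Finset.sum_sub_distrib ..
  simp_rw [h]
  rw [Finset.sum_range_sub (fun r => ∑ o, eagerShare R P r j o) r]
  simp [eagerShare, eagerBefore]

/-- An agent is eager for at most one item per round. The difference is zero if she was already
eager for it before. -/
theorem roundShare_of_mem {r : ℕ} {j : N} {o : M} (h : j ∈ eagerAgents R P r o) :
    roundShare R P j r = eagerShare R P (r + 1) j o - eagerShare R P r j o := by
  refine Finset.sum_eq_single o (fun o' _ hne => ?_) fun h' => absurd (Finset.mem_univ o) h'
  rw [eagerShare_succ_of_notMem, sub_self]
  exact fun h' => hne ((mem_topAgents.1 h).eq (mem_topAgents.1 h'))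

theorem eagerShare_nonneg (hP : IsRandomAssignment P) (r : ℕ) (j : N) (o : M) :
    0 ≤ eagerShare R P r j o := by
  classical
  rw [eagerShare]
  split_ifs
  exacts [hP.nonneg j o, le_rfl]

theorem eagerShare_le (hP : IsRandomAssignment P) (r : ℕ) (j : N) (o : M) :
    eagerShare R P r j o ≤ P j o := by
  classical
  rw [eagerShare]
  split_ifs
  exacts [le_rfl, hP.nonneg j o]

theorem eagerShare_le_succ (hP : IsRandomAssignment P) (r : ℕ) (j : N) (o : M) :
    eagerShare R P r j o ≤ eagerShare R P (r + 1) j o := by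
  by_cases h : j ∈ eagerBefore R P r o
  · rw [eagerShare_of_mem h, eagerShare_of_mem (mem_eagerBefore_succ.2 (Or.inl h))]
  · rw [eagerShare_of_notMem h]
    exact eagerShare_nonneg hP _ j o

theorem eagerShare_row_sum_le (hP : IsRandomAssignment P) (r : ℕ) (j : N) :
    ∑ o, eagerShare R P r j o ≤ 1 := by
  rw [← hP.row_sum j]
  exact Finset.sum_le_sum fun o _ => eagerShare_le hP r j o

theorem eagerShare_col_sum_le (hP : IsRandomAssignment P) (r : ℕ) (o : M) :
    ∑ j, eagerShare R P r j o ≤ 1 := by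
  rw [← hP.col_sum o]
  exact Finset.sum_le_sum fun j _ => eagerShare_le hP r j o

theorem roundShare_nonneg (hP : IsRandomAssignment P) (j : N) (r : ℕ) :
    0 ≤ roundShare R P j r :=
  Finset.sum_nonneg fun o _ => sub_nonneg.2 (eagerShare_le_succ hP r j o)

/-- The agents who were eager for an item before it ran out get all of it. -/
theorem eagerShare_eq_of_notMem_remainingItems (hP : IsRandomAssignment P) {r : ℕ} {o : M}
    (ho : o ∉ remainingItems R P r) (j : N) : eagerShare R P r j o = P j o := by
  rw [mem_remainingItems, not_lt] at ho
  exact (Finset.sum_eq_sum_iff_of_le fun j _ => eagerShare_le hP r j o).1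
    ((le_antisymm (eagerShare_col_sum_le hP r o) ho).trans (hP.col_sum o).symm) j
    (Finset.mem_univ j)

theorem remainingItems_succ_subset (hP : IsRandomAssignment P) (r : ℕ) :
    remainingItems R P (r + 1) ⊆ remainingItems R P r := fun o ho => by
  rw [mem_remainingItems] at ho ⊢
  exact (Finset.sum_le_sum fun j _ => eagerShare_le_succ hP r j o).trans_lt ho

theorem eq_zero_of_notMem_upperContour (hP : IsRandomAssignment P) {j : N} {o o' : M}
    (h : ∑ o' ∈ upperContour R j o, P j o' = 1) (ho' : o' ∉ upperContour R j o) : P j o' = 0 := by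
  classical
  have h1 := Finset.sum_add_sum_compl (upperContour R j o) (P j)
  rw [h, hP.row_sum, add_eq_left, Finset.sum_eq_zero_iff_of_nonneg fun o _ => hP.nonneg j o] at h1
  exact h1 o' (Finset.mem_compl.2 ho')

/-- If an item survives a FERI round, then the agents eager for it get nothing else later on. -/
theorem ExAnteFERI.eagerShare_eq (hF : ExAnteFERI R P) (hP : IsRandomAssignment P)
    {r s : ℕ} {j : N} {o : M} (hrs : r < s) (hj : j ∈ eagerAgents R P r o)
    (ho : o ∈ remainingItems R P s) (o' : M) : eagerShare R P s j o' = P j o' := by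
  by_cases h : o' ∈ upperContour R j o
  · rcases mem_upperContour.1 h with h1 | rfl
    -- An item strictly better than `o` is gone by round `r`, when `o` is the top of `j`, and
    -- remains gone in round `s`.
    · refine eagerShare_eq_of_notMem_remainingItems hP (fun h2 => ?_) j
      have h3 : o' ∈ remainingItems R P r :=
        antitone_nat_of_succ_le (remainingItems_succ_subset hP) hrs.le h2
      have h4 := (mem_topAgents.1 hj).2 o' h3
      by_cases h5 : o' = o
      · exact R.asymm j h1 (by simpa [h5] using h1)
      · exact R.asymm j h1 (h4 h5)
    · exact eagerShare_of_mem ((mem_eagerBefore R P s o' j).2 ⟨r, hrs, hj⟩)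
  · refine le_antisymm (eagerShare_le hP s j o') ?_
    rw [eq_zero_of_notMem_upperContour hP (hF s o ho j ⟨r, hrs, hj⟩) h]
    exact eagerShare_nonneg hP s j o'

/-- Counterpart of `PREState.Consistent.card_step_available_lt`: if the top item of every agent
survived, `ExAnteFERI.eagerShare_eq` would account for all of `P`, and every column would be full.
-/
theorem ExAnteFERI.remainingItems_succ_ne (hF : ExAnteFERI R P) (hP : IsRandomAssignment P)
    {r : ℕ} (hne : remainingItems R P r ≠ ∅) : remainingItems R P (r + 1) ≠ remainingItems R P r := by
  intro heq
  obtain ⟨o, ho⟩ := Finset.nonempty_iff_ne_empty.2 hne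
  rw [← heq, mem_remainingItems] at ho
  refine ho.ne ?_
  rw [← hP.col_sum o]
  refine Finset.sum_congr rfl fun j _ => ?_
  obtain ⟨o', ho'⟩ := exists_isTopItem R j (Finset.nonempty_iff_ne_empty.2 hne)
  exact hF.eagerShare_eq hP r.lt_succ_self (mem_topAgents.2 ho') (heq ▸ ho'.1) o

theorem ExAnteFERI.remainingItems_card (hF : ExAnteFERI R P) (hP : IsRandomAssignment P) :
    remainingItems R P (Fintype.card M) = ∅ := by
  have h : ∀ r, (remainingItems R P r).card ≤ Fintype.card M - r := by
    intro r
    induction r with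
    | zero => exact Finset.card_le_univ _
    | succ r ih =>
      have h1 := remainingItems_succ_subset (R := R) hP r
      by_cases hne : remainingItems R P r = ∅
      · rw [hne] at h1
        simp [Finset.subset_empty.1 h1]
      · have := Finset.card_lt_card (h1.ssubset_of_ne (hF.remainingItems_succ_ne hP hne))
        omega
  simpa using h (Fintype.card M)

theorem ExAnteFERI.eagerShare_of_card_le (hF : ExAnteFERI R P) (hP : IsRandomAssignment P)
    {r : ℕ} (hr : Fintype.card M ≤ r) : eagerShare R P r = P := by
  funext j o
  refine eagerShare_eq_of_notMem_remainingItems hP (fun h => ?_) j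
  have h1 := antitone_nat_of_succ_le (remainingItems_succ_subset (R := R) hP) hr h
  simp [hF.remainingItems_card hP] at h1

/-! ### The algorithm reproduces a FERI assignment -/

/-- The eating speed functions that realise `P`: in round `r` every agent eats her share of the
item she is eager for. -/
noncomputable def feriSpeed (R : PrefProfile N M) (P : N → M → ℝ) (j : N) : ℝ → ℝ :=
  stepSpeed (Fintype.card M) (roundShare R P j)

theorem ExAnteFERI.isEatingSpeed_feriSpeed (hF : ExAnteFERI R P) (hP : IsRandomAssignment P)
    (hM : 0 < Fintype.card M) (j : N) : IsEatingSpeed (feriSpeed R P j) := by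
  refine isEatingSpeed_stepSpeed hM (roundShare_nonneg hP j) ?_ fun r hr => ?_
  · rw [sum_range_roundShare, hF.eagerShare_of_card_le hP le_rfl, hP.row_sum]
  · rw [roundShare, hF.eagerShare_of_card_le hP hr, hF.eagerShare_of_card_le hP (by omega)]
    simp

/-- State `σ` is the one reached by `feriSpeed R P` after `r` rounds. -/
structure PREState.Follows (R : PrefProfile N M) (P : N → M → ℝ) (r : ℕ) (σ : PREState N M) :
    Prop where
  share_eq : σ.share = eagerShare R P r
  sated_or_time_eq : σ.available ≠ ∅ → ∀ j, ∑ o, σ.share j o = 1 ∨ σ.time j = r / Fintype.card M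

namespace PREState

variable {σ : PREState N M} {r : ℕ}

theorem Follows.available_eq {ω : N → ℝ → ℝ} (h : σ.Follows R P r) (hc : σ.Consistent ω) :
    σ.available = remainingItems R P r := by
  ext o
  have h1 := hc.supply_nonneg o
  have h2 := hc.supply_eq o
  rw [hc.mem_available, mem_remainingItems, ← h.share_eq, ← h1.lt_iff_ne', h2, sub_pos]

theorem row_sum_eagerShare_succ (j : N) :
    ∑ o, eagerShare R P (r + 1) j o = ∑ o, eagerShare R P r j o + roundShare R P j r := by
  rw [← sum_range_roundShare, ← sum_range_roundShare, Finset.sum_range_succ]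

/-- A sated agent may be at any time, but both sides vanish: she has no demand left, and her row in
`P` is full. Any other agent stands at the start of the `r`-th interval. -/
theorem Follows.integral_eq (h : σ.Follows R P r) (hc : σ.Consistent (feriSpeed R P))
    (hω : ∀ j, IsEatingSpeed (feriSpeed R P j)) (hP : IsRandomAssignment P)
    (hM : 0 < Fintype.card M) (hne : σ.available ≠ ∅) (j : N) {ρ : ℝ} (h0 : 0 ≤ ρ)
    (h1 : ρ ≤ 1 / Fintype.card M) :
    ∫ x in (σ.time j)..(σ.time j + ρ), feriSpeed R P j x =
      Fintype.card M * ρ * roundShare R P j r := by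
  rcases h.sated_or_time_eq hne j with h2 | h2
  · have h3 := (hω j).integral_add_demand (hc.time_nonneg j) h0
    have h4 := (hω j).integral_nonneg (hc.time_nonneg j) h0
    have h5 := (hω j).demand_nonneg (add_nonneg (hc.time_nonneg j) h0)
    rw [hc.demand_eq] at h3
    have h6 := row_sum_eagerShare_succ (R := R) (P := P) (r := r) j
    rw [← h.share_eq] at h6
    have h7 := eagerShare_row_sum_le (R := R) hP (r + 1) j
    have h8 := roundShare_nonneg (R := R) hP j r
    have h9 : roundShare R P j r = 0 := by linarith
    rw [h9]
    linarith
  · rw [h2]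
    exact integral_stepSpeed hM r h0 h1

theorem Follows.supply_sub (h : σ.Follows R P r) {ω : N → ℝ → ℝ} (hc : σ.Consistent ω) (o : M) :
    σ.supply o - ∑ j ∈ topAgents R σ.available o, roundShare R P j r =
      1 - ∑ j, eagerShare R P (r + 1) j o := by
  have h1 : ∀ j ∈ topAgents R σ.available o, roundShare R P j r =
      eagerShare R P (r + 1) j o - eagerShare R P r j o := fun j hj => by
    rw [h.available_eq hc] at hj
    exact roundShare_of_mem hj
  rw [hc.supply_eq, h.share_eq, Finset.sum_congr rfl h1,
    Finset.sum_subset (Finset.subset_univ (topAgents R σ.available o)), Finset.sum_sub_distrib]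
  · ring
  · intro j _ hj
    rw [h.available_eq hc] at hj
    rw [eagerShare_succ_of_notMem hj, sub_self]

/-- An item that runs out in round `r` is eaten for exactly one time interval. -/
theorem Follows.duration_eq (h : σ.Follows R P r) (hc : σ.Consistent (feriSpeed R P))
    (hω : ∀ j, IsEatingSpeed (feriSpeed R P j)) (hP : IsRandomAssignment P)
    (hM : 0 < Fintype.card M) {o : M} (ho : o ∈ σ.available)
    (ho' : o ∉ remainingItems R P (r + 1)) :
    σ.duration R (feriSpeed R P) o = 1 / Fintype.card M := by
  have hM' : (0 : ℝ) < Fintype.card M := by exact_mod_cast hM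
  have hne : σ.available ≠ ∅ := Finset.ne_empty_of_mem ho
  have hs : ∑ j ∈ topAgents R σ.available o, roundShare R P j r = σ.supply o := by
    have h1 := h.supply_sub hc o
    simp_rw [eagerShare_eq_of_notMem_remainingItems hP ho', hP.col_sum] at h1
    linarith
  have hpos : 0 < σ.supply o := (hc.supply_nonneg o).lt_of_ne' ((hc.mem_available o).1 ho)
  have hF : ∀ ρ : ℝ, 0 ≤ ρ → ρ ≤ 1 / Fintype.card M →
      ∑ j ∈ topAgents R σ.available o, ∫ x in (σ.time j)..(σ.time j + ρ), feriSpeed R P j x =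
        Fintype.card M * ρ * σ.supply o := fun ρ h0 h1 => by
    rw [← hs, Finset.mul_sum]
    exact Finset.sum_congr rfl fun j _ => h.integral_eq hc hω hP hM hne j h0 h1
  -- Rules out stopping early by satiation: before the interval ends, the linear consumption is
  -- below the supply, hence below the total demand.
  have hdemand : σ.supply o ≤
      ∑ j ∈ topAgents R σ.available o, ∫ x in (σ.time j)..1, feriSpeed R P j x := by
    rw [← hs]
    refine Finset.sum_le_sum fun j _ => ?_
    have h1 := eagerShare_row_sum_le (R := R) hP (r + 1) j
    rw [row_sum_eagerShare_succ] at h1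
    rw [hc.demand_eq, h.share_eq]
    linarith
  refine (isLeast_consumptionTime hω _ hc.time_nonneg _).unique ⟨Or.inl ⟨by positivity, ?_⟩, ?_⟩
  · rw [hF _ (by positivity) le_rfl]
    field_simp
  · intro ρ hρ
    by_contra! hlt
    have h1 : (Fintype.card M : ℝ) * ρ < 1 := by rwa [lt_div_iff₀' hM'] at hlt
    rcases hρ with ⟨h0, h2⟩ | ⟨h0, h2⟩
    · rw [hF _ h0 hlt.le] at h2
      nlinarith
    · rw [hF _ h0.1 hlt.le] at h2
      nlinarith

/-- The agents who eat an item that survives round `r` eat up their demand. -/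
theorem Follows.row_sum_step_eq_one (h : σ.Follows R P r) (hc : σ.Consistent (feriSpeed R P))
    (hω : ∀ j, IsEatingSpeed (feriSpeed R P j)) (hP : IsRandomAssignment P)
    (hF : ExAnteFERI R P) {j : N} {o : M} (hj : j ∈ topAgents R σ.available o)
    (ho : o ∈ remainingItems R P (r + 1)) :
    ∑ o', (σ.step R (feriSpeed R P)).share j o' = 1 ∧
      ∑ o', eagerShare R P (r + 1) j o' = 1 := by
  have hc' := hc.step hω (R := R)
  have hsum : ∀ k ∈ topAgents R σ.available o, ∑ o', eagerShare R P (r + 1) k o' = 1 :=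
    fun k hk => by
      rw [h.available_eq hc] at hk
      rw [← hP.row_sum k]
      exact Finset.sum_congr rfl fun o' _ => hF.eagerShare_eq hP r.lt_succ_self hk ho o'
  refine ⟨hc.row_sum_step_eq_one hω hj ((hc'.mem_available o).2 fun h0 => ?_), hsum j hj⟩
  have h1 : σ.supply o - ∑ k ∈ topAgents R σ.available o, σ.amount R (feriSpeed R P) k o = 0 := h0
  -- The round shares fill the eaters' rows exactly, so nobody can eat more than hers; together
  -- these fall short of the supply, since `o` remains.
  have h2 : ∑ k ∈ topAgents R σ.available o, σ.amount R (feriSpeed R P) k o ≤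
      ∑ k ∈ topAgents R σ.available o, roundShare R P k r := by
    refine Finset.sum_le_sum fun k hk => ?_
    have h3 := hc'.row_sum_le hω k
    have h4 := hsum k hk
    rw [step_row_sum_of_mem hk, h.share_eq] at h3
    rw [row_sum_eagerShare_succ] at h4
    linarith
  have h3 := h.supply_sub hc o
  have h4 := mem_remainingItems.1 ho
  linarith

/-- If the item eaten survives, the amount is forced by satiation on both sides; if it runs out, by
the duration of one full interval. -/
theorem Follows.step (h : σ.Follows R P r) (hc : σ.Consistent (feriSpeed R P))
    (hω : ∀ j, IsEatingSpeed (feriSpeed R P j)) (hP : IsRandomAssignment P)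
    (hF : ExAnteFERI R P) (hM : 0 < Fintype.card M) :
    (σ.step R (feriSpeed R P)).Follows R P (r + 1) := by
  by_cases hne : σ.available = ∅
  · rw [step_eq_self hne]
    refine ⟨?_, fun h' => absurd hne h'⟩
    have h1 := h.available_eq hc
    rw [h.share_eq]
    funext j o
    rw [eagerShare_succ_of_notMem]
    rw [eagerAgents, ← h1, hne, topAgents_empty]
    simp
  have key : ∀ j o, j ∈ topAgents R σ.available o →
      σ.amount R (feriSpeed R P) j o = roundShare R P j r ∧
      (∑ o, (σ.step R (feriSpeed R P)).share j o = 1 ∨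
        σ.duration R (feriSpeed R P) o = 1 / Fintype.card M) := by
    intro j o hj
    by_cases ho : o ∈ remainingItems R P (r + 1)
    · obtain ⟨h1, h2⟩ := h.row_sum_step_eq_one hc hω hP hF hj ho
      refine ⟨?_, Or.inl h1⟩
      rw [step_row_sum_of_mem hj, h.share_eq] at h1
      rw [row_sum_eagerShare_succ] at h2
      linarith
    · have h1 := h.duration_eq hc hω hP hM (mem_topAgents.1 hj).1 ho
      refine ⟨?_, Or.inr h1⟩
      rw [amount, h1, h.integral_eq hc hω hP hM hne j (by positivity) le_rfl]
      field_simp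
  refine ⟨?_, fun _ j => ?_⟩
  · funext j o
    by_cases hj : j ∈ topAgents R σ.available o
    · rw [step_share_of_mem hj, (key j o hj).1, h.share_eq, roundShare_of_mem (o := o)]
      · ring
      · rwa [eagerAgents, ← h.available_eq hc]
    · rw [step_share_of_notMem hj, h.share_eq, eagerShare_succ_of_notMem]
      rwa [eagerAgents, ← h.available_eq hc]
  · obtain ⟨o, hj⟩ := exists_mem_topAgents R hne j
    rcases (key j o hj).2 with h1 | h1
    · exact Or.inl h1
    · rcases h.sated_or_time_eq hne j with h2 | h2
      -- An agent sated earlier stays sated, whatever her clock shows.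
      · refine Or.inl (le_antisymm ((hc.step hω).row_sum_le hω j) ?_)
        rw [← h2]
        exact Finset.sum_le_sum fun o' _ => hc.share_le_step hω j o'
      · right
        rw [step_time_of_mem hj, h1, h2]
        push_cast
        ring

end PREState

theorem ExAnteFERI.eq_PRE (hcard : Fintype.card N = Fintype.card M) (hF : ExAnteFERI R P)
    (hP : IsRandomAssignment P) (hM : 0 < Fintype.card M) : P = PRE R (feriSpeed R P) := by
  have hω := hF.isEatingSpeed_feriSpeed hP hM
  have h : ∀ r, (preState R (feriSpeed R P) r).Follows R P r := by
    intro r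
    induction r with
    | zero =>
      refine ⟨?_, fun _ j => Or.inr ?_⟩
      · funext j o
        simp [preState, PREState.init, eagerShare, eagerBefore]
      · simp [preState, PREState.init]
    | succ r ih =>
      rw [preState_succ]
      exact ih.step (preState_consistent R hω r) hω hP hF hM
  rw [PRE_eq_share hcard R hω, (h _).share_eq, hF.eagerShare_of_card_le hP le_rfl]

end Eager

theorem mainTheorem3 {N M : Type*} [Fintype N] [Fintype M]
    (hcard : Fintype.card N = Fintype.card M) (R : PrefProfile N M) :
    (∀ ω : N → ℝ → ℝ, (∀ j, IsEatingSpeed (ω j)) →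
      PREHalts R ω ∧ IsRandomAssignment (PRE R ω)) ∧
    ∀ P : N → M → ℝ, IsRandomAssignment P →
      (ExAnteFERI R P ↔ ∃ ω : N → ℝ → ℝ, (∀ j, IsEatingSpeed (ω j)) ∧ P = PRE R ω) := by
  refine ⟨fun ω hω => ⟨⟨_, preState_available_card hcard R hω⟩,
    PRE_isRandomAssignment hcard R hω⟩, fun P hP => ⟨fun hF => ?_, ?_⟩⟩
  -- Without items there are no intervals to cut time into, but then there are no agents either and
  -- any `ω` works.
  · rcases (Fintype.card M).eq_zero_or_pos with hM | hM
    · have : IsEmpty N := Fintype.card_eq_zero_iff.1 (hcard.trans hM)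
      exact ⟨fun _ _ => 0, isEmptyElim, Subsingleton.elim _ _⟩
    · exact ⟨feriSpeed R P, hF.isEatingSpeed_feriSpeed hP hM, hF.eq_PRE hcard hP hM⟩
  · rintro ⟨ω, hω, rfl⟩
    exact PRE_exAnteFERI hcard R hω
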